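/- Let $X\subseteq\mathbb{R}^n$ be a set (for instance a smooth submanifold or a real algebraic variety of dimension $d$). A *chart* of $X$ around $s$ is a $C^\infty$ immersion $p:U\to\mathbb{R}^n$ of an open neighbourhood $U\subseteq\mathbb{R}^d$ of $0$ with $p(0)=s$ that is a homeomorphism onto a relatively open subset of $X$. Let $X_{\rm reg}$ be the set of points of $X$ that admit such a chart, that is, the points near which $X$ is an embedded $C^\infty$ submanifold of dimension $d$. For $s\in X_{\rm reg}$ let $T_sX=\operatorname{im} dp(0)$ for a chart $p$ around $s$. Let $\Sigma$ be a real symmetric positive definite $n\times n$ matrix. For $t\in\mathbb{R}^n$ put $L_{t,\Sigma}(x)=(x-t)^\top\Sigma(x-t)$ and $$\operatorname{Crit}(L_{t,\Sigma}|_X)=\{s\in X_{\rm reg} : dL_{t,\Sigma}(s)\text{ vanishes on }T_sX\}.$$ For $s\in\operatorname{Crit}(L_{t,\Sigma}|_X)$ let $H_{L_{t,\Sigma}}(s)$ be the Hessian matrix at $0$ of $L_{t,\Sigma}\circ p$, for a chart $p$ around $s$; its rank and signature do not depend on $p$. The focal locus $F_{X,\Sigma}$ is the set of all $t\in\mathbb{R}^n$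 for which there is $s\in\operatorname{Crit}(L_{t,\Sigma}|_X)$ with $\det H_{L_{t,\Sigma}}(s)=0$. A point $y\in\mathbb{R}^n$ is a *focal point of $(X,s)$ of multiplicity $m\ge 1$* if $s\in\operatorname{Crit}(L_{y,\Sigma}|_X)$, $\det H_{L_{y,\Sigma}}(s)=0$, and $H_{L_{y,\Sigma}}(s)$ has nullity $m$. **Theorem.** Let $t\in\mathbb{R}^n\setminus F_{X,\Sigma}$ and $s\in\operatorname{Crit}(L_{t,\Sigma}|_X)$. Then the segment from $s$ to $t$ contains only finitely many focal points of $(X,s)$, and the index of $L_{t,\Sigma}|_X$ at $s$, that is, the number of negative eigenvalues of $H_{L_{t,\Sigma}}(s)$ counted with multiplicity, computed in any chart of $X$ around $s$, equals the number of focal points of $(X,s)$ on the segment from $s$ to $t$, each counted with its multiplicity. -/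

import Mathlib

open scoped ContDiff Matrix

noncomputable section

namespace DistanceLandscape

/-- The squared distance `L_{t,Σ}(x) = ‖x - t‖_Σ² = (x - t)ᵀ Σ (x - t)` to the point `t` (the
teacher) for the inner product on `ℝⁿ` with Gram matrix `S = Σ`. -/
def sqDist {n : ℕ} (S : Matrix (Fin n) (Fin n) ℝ) (t x : Fin n → ℝ) : ℝ :=
  (x - t) ⬝ᵥ (S *ᵥ (x - t))

/-- `p : U → p(U)` is a smooth chart (local parametrization) of `X ⊆ ℝⁿ` around `s`:
`U ⊆ ℝᵈ` is an open neighbourhood of `0`, `p(0) = s`, `p` is a `C^∞` immersion on `U`, and `p` is a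
homeomorphism from `U` onto a relatively open subset of `X`. -/
structure IsChart {n d : ℕ} (X : Set (Fin n → ℝ)) (s : Fin n → ℝ)
    (U : Set (Fin d → ℝ)) (p : (Fin d → ℝ) → (Fin n → ℝ)) : Prop where
  isOpen_source : IsOpen U
  zero_mem : (0 : Fin d → ℝ) ∈ U
  map_zero : p 0 = s
  contDiffOn : ContDiffOn ℝ ∞ p U
  injective_fderiv : ∀ u ∈ U, Function.Injective (fderiv ℝ p u)
  isEmbedding : Topology.IsEmbedding (U.domRestrict p)
  isOpen_image : ∃ W : Set (Fin n → ℝ), IsOpen W ∧ p '' U = X ∩ W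

/-- `X_reg`: the smooth points of `X`, that is, the points near which `X` is an embedded `C^∞`
submanifold of dimension `d`. If `X` is a `d`-dimensional submanifold, this is all of `X`. -/
def regularPoints {n : ℕ} (X : Set (Fin n → ℝ)) (d : ℕ) : Set (Fin n → ℝ) :=
  {s | ∃ (U : Set (Fin d → ℝ)) (p : (Fin d → ℝ) → (Fin n → ℝ)), IsChart X s U p}

/-- The tangent space `T_s X` at a smooth point `s`: the image of the differential at `0` of a
chart around `s` (all charts around `s` have the same image). -/
def tangentSpace {n : ℕ} (X : Set (Fin n → ℝ)) (d : ℕ) (s : Fin n → ℝ) : Set (Fin n → ℝ) :=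
  {w | ∃ (U : Set (Fin d → ℝ)) (p : (Fin d → ℝ) → (Fin n → ℝ)),
    IsChart X s U p ∧ w ∈ Set.range (fderiv ℝ p 0)}

/-- `Crit(L_{t,Σ}|_X)`: the smooth points of `X` at which the differential of `L_{t,Σ}` vanishes in
all directions tangent to `X`. -/
def crit {n : ℕ} (X : Set (Fin n → ℝ)) (d : ℕ) (S : Matrix (Fin n) (Fin n) ℝ) (t : Fin n → ℝ) :
    Set (Fin n → ℝ) :=
  {s | s ∈ regularPoints X d ∧ ∀ w ∈ tangentSpace X d s, fderiv ℝ (sqDist S t) s w = 0}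

/-- The Hessian matrix `(∂²(L_{t,Σ} ∘ p) / ∂uᵢ∂uⱼ)(0)` in the chart `p`. -/
def chartHessian {n d : ℕ} (S : Matrix (Fin n) (Fin n) ℝ) (t : Fin n → ℝ)
    (p : (Fin d → ℝ) → (Fin n → ℝ)) : Matrix (Fin d) (Fin d) ℝ :=
  Matrix.of fun i j =>
    fderiv ℝ (fderiv ℝ (fun u => sqDist S t (p u))) 0 (Pi.single i 1) (Pi.single j 1)

/-- The number of negative eigenvalues of a real square matrix, counted with (algebraic)
multiplicity; it is applied to symmetric matrices only. -/
def negEigenvalueCount {d : ℕ} (H : Matrix (Fin d) (Fin d) ℝ) : ℕ :=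
  (H.charpoly.roots.filter fun x => x < 0).card

/-- The nullity (dimension of the kernel) of a matrix. -/
def nullity {d : ℕ} (H : Matrix (Fin d) (Fin d) ℝ) : ℕ :=
  Module.finrank ℝ (LinearMap.ker H.mulVecLin)

/-- `Z_X`: the triples `(s, t, Σ)` with `Σ` positive definite such that `s` is a degenerate critical
point of `L_{t,Σ}|_X`. At a critical point the rank of the Hessian is the same in all charts. -/
def degenerateTriples {n : ℕ} (X : Set (Fin n → ℝ)) (d : ℕ) :
    Set ((Fin n → ℝ) × (Fin n → ℝ) × Matrix (Fin n) (Fin n) ℝ) :=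
  {z | z.2.2.PosDef ∧ z.1 ∈ crit X d z.2.2 z.2.1 ∧
    ∃ (U : Set (Fin d → ℝ)) (p : (Fin d → ℝ) → (Fin n → ℝ)),
      IsChart X z.1 U p ∧ (chartHessian z.2.2 z.2.1 p).det = 0}

/-- `F_X`: the pairs `(t, Σ)` such that `L_{t,Σ}|_X` has a degenerate critical point. -/
def extendedFocalLocus {n : ℕ} (X : Set (Fin n → ℝ)) (d : ℕ) :
    Set ((Fin n → ℝ) × Matrix (Fin n) (Fin n) ℝ) :=
  {z | ∃ s, (s, z.1, z.2) ∈ degenerateTriples X d}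

/-- The focal locus `F_{X,Σ}`. -/
def focalLocus {n : ℕ} (X : Set (Fin n → ℝ)) (d : ℕ) (S : Matrix (Fin n) (Fin n) ℝ) :
    Set (Fin n → ℝ) :=
  {t | (t, S) ∈ extendedFocalLocus X d}

/-- `y` is a focal point of `(X, s)` of multiplicity `m ≥ 1` for the distance given by `S = Σ`. -/
def IsFocalPoint {n : ℕ} (X : Set (Fin n → ℝ)) (d : ℕ) (S : Matrix (Fin n) (Fin n) ℝ)
    (s y : Fin n → ℝ) (m : ℕ) : Prop :=
  1 ≤ m ∧ (s, y, S) ∈ degenerateTriples X d ∧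
    ∃ (U : Set (Fin d → ℝ)) (p : (Fin d → ℝ) → (Fin n → ℝ)),
      IsChart X s U p ∧ nullity (chartHessian S y p) = m

/-- The multiplicity of `y` as a focal point of `(X, s)`: the unique `m` with `IsFocalPoint … m`
(the nullity of the Hessian at a critical point is the same in all charts), and `0` if `y` is not a
focal point. -/
def focalMultiplicity {n : ℕ} (X : Set (Fin n → ℝ)) (d : ℕ) (S : Matrix (Fin n) (Fin n) ℝ)
    (s y : Fin n → ℝ) : ℕ :=
  sSup {m | IsFocalPoint X d S s y m}

end DistanceLandscape

end

/-! Write `y_r = s + r(t - s)`. The point `s` remains critical for every `y_r`, and in a fixed chart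
the Hessian at `y_r` is `(1 - r) G + r H`, where `G` and `H` are the Hessians for `s` and `t`
(`IsChart.chartHessian_lineMap`). Since `G` is twice the `S`-inner product pulled back to the
tangent space, it is positive definite, so some invertible `R` gives `G = Rᵀ R` and `H = Rᵀ diag(ν)
R` (`exists_simultaneous_diagonalization`).

The multiplicity of `y_r` is then the number of `i` with `1 - r + r ν i = 0`. No `ν i` is zero
because `t` is not focal; a negative `ν i` contributes exactly one root, `1 / (1 - ν i)`, in `[0,
1]`, and a positive one contributes none. Hence the multiplicities add up to the number of negative
`ν i`, which is the index of `H` by Sylvester's law of inertia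
(`negEigenvalueCount_congruence_diagonal`). -/

namespace DistanceLandscape

/-! ### Inertia and simultaneous diagonalization of quadratic forms -/

section LinearAlgebra

variable {d : ℕ}

theorem dotProduct_congruence_diagonal (a : Fin d → ℝ) (R : Matrix (Fin d) (Fin d) ℝ)
    (x : Fin d → ℝ) :
    x ⬝ᵥ ((Rᵀ * Matrix.diagonal a * R) *ᵥ x) = ∑ i, a i * (R *ᵥ x) i ^ 2 := by
  rw [← Matrix.mulVec_mulVec, ← Matrix.mulVec_mulVec, Matrix.dotProduct_mulVec,
    Matrix.vecMul_transpose]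
  simp only [dotProduct, Matrix.mulVec_diagonal]
  exact Finset.sum_congr rfl fun i _ => by ring

/-- One half of **Sylvester's law of inertia**. -/
theorem card_neg_le_of_congruence {a b : Fin d → ℝ} {R T : Matrix (Fin d) (Fin d) ℝ}
    (hR : IsUnit R.det) (h : Rᵀ * Matrix.diagonal a * R = Tᵀ * Matrix.diagonal b * T) :
    Fintype.card {i // a i < 0} ≤ Fintype.card {i // b i < 0} := by
  -- On the kernel of `f` the form is a sum of nonpositive terms in the `a`-coordinates and of
  -- nonnegative ones in the `b`-coordinates, hence zero; strict negativity of the `a i` then kills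
  -- the vector.
  let f : ({i // a i < 0} → ℝ) →ₗ[ℝ] ({i // b i < 0} → ℝ) :=
    LinearMap.funLeft ℝ ℝ Subtype.val ∘ₗ T.mulVecLin ∘ₗ R⁻¹.mulVecLin ∘ₗ
      Function.ExtendByZero.linearMap ℝ Subtype.val
  suffices hf : Function.Injective f by
    simpa using LinearMap.finrank_le_finrank_of_injective hf
  refine (injective_iff_map_eq_zero f).2 fun z hz => ?_
  set w : Fin d → ℝ := Function.extend Subtype.val z 0 with hw
  have hRw : R *ᵥ (R⁻¹ *ᵥ w) = w := by
    rw [Matrix.mulVec_mulVec, Matrix.mul_nonsing_inv _ hR, Matrix.one_mulVec]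
  have hT : ∀ i, b i < 0 → (T *ᵥ (R⁻¹ *ᵥ w)) i = 0 := fun i hi => congrFun hz ⟨i, hi⟩
  have hq : ∑ i, a i * w i ^ 2 = ∑ i, b i * (T *ᵥ (R⁻¹ *ᵥ w)) i ^ 2 := by
    rw [← dotProduct_congruence_diagonal, ← h, dotProduct_congruence_diagonal, hRw]
  have hb : 0 ≤ ∑ i, b i * (T *ᵥ (R⁻¹ *ᵥ w)) i ^ 2 := by
    refine Finset.sum_nonneg fun i _ => ?_
    rcases lt_or_ge (b i) 0 with hi | hi
    · simp [hT i hi]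
    · positivity
  have ha : ∀ i ∈ Finset.univ, a i * w i ^ 2 ≤ 0 := by
    intro i _
    rcases lt_or_ge (a i) 0 with hi | hi
    · exact mul_nonpos_of_nonpos_of_nonneg hi.le (sq_nonneg _)
    · have : w i = 0 := by
        rw [hw, Function.extend_apply' _ _ _ (by rintro ⟨j, rfl⟩; exact absurd j.2 hi.not_gt)]
        rfl
      simp [this]
  have h0 := (Finset.sum_eq_zero_iff_of_nonpos ha).1
    (le_antisymm (Finset.sum_nonpos ha) (hq ▸ hb))
  funext i
  have hi := h0 i.1 (Finset.mem_univ _)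
  rw [hw, Subtype.val_injective.extend_apply] at hi
  simpa [i.2.ne] using hi

/-- The spectral theorem for a real symmetric matrix, with the eigenvalues of the library. -/
theorem exists_orthogonal_diagonalization {H : Matrix (Fin d) (Fin d) ℝ} (hH : H.IsHermitian) :
    ∃ U : Matrix (Fin d) (Fin d) ℝ, Uᵀ * U = 1 ∧
      H = Uᵀ * Matrix.diagonal hH.eigenvalues * U := by
  refine ⟨(hH.eigenvectorUnitary : Matrix (Fin d) (Fin d) ℝ)ᵀ, ?_, ?_⟩
  · have := Unitary.mul_star_self_of_mem hH.eigenvectorUnitary.2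
    simpa [Matrix.star_eq_conjTranspose] using this
  · have := hH.spectral_theorem
    simpa [Unitary.conjStarAlgAut_apply, Matrix.star_eq_conjTranspose, Function.comp_def] using this

theorem isUnit_det_of_transpose_mul_self {U : Matrix (Fin d) (Fin d) ℝ} (hU : Uᵀ * U = 1) :
    IsUnit U.det :=
  (Matrix.isUnit_iff_isUnit_det _).1 (IsUnit.of_mul_eq_one_right _ hU)

theorem isHermitian_congruence_diagonal (a : Fin d → ℝ) (R : Matrix (Fin d) (Fin d) ℝ) :
    (Rᵀ * Matrix.diagonal a * R).IsHermitian := by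
  simp [Matrix.IsHermitian, Matrix.mul_assoc]

/-- **Sylvester's law of inertia**: the number of negative eigenvalues can be read off from any
diagonalization by congruence. -/
theorem negEigenvalueCount_congruence_diagonal (a : Fin d → ℝ) {R : Matrix (Fin d) (Fin d) ℝ}
    (hR : IsUnit R.det) :
    negEigenvalueCount (Rᵀ * Matrix.diagonal a * R) = Fintype.card {i // a i < 0} := by
  have hH := isHermitian_congruence_diagonal a R
  obtain ⟨U, hU, hUH⟩ := exists_orthogonal_diagonalization hH
  have : negEigenvalueCount (Rᵀ * Matrix.diagonal a * R) =
      Fintype.card {i // hH.eigenvalues i < 0} := by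
    rw [negEigenvalueCount, hH.roots_charpoly_eq_eigenvalues, Multiset.filter_map,
      Multiset.card_map, Fintype.card_subtype]
    rfl
  rw [this]
  exact le_antisymm (card_neg_le_of_congruence (isUnit_det_of_transpose_mul_self hU) hUH.symm)
    (card_neg_le_of_congruence hR hUH)

theorem nullity_add_rank (H : Matrix (Fin d) (Fin d) ℝ) : nullity H + H.rank = d := by
  have := LinearMap.finrank_range_add_finrank_ker H.mulVecLin
  rw [Module.finrank_fin_fun] at this
  rw [nullity, Matrix.rank, add_comm, this]

theorem nullity_congruence (H : Matrix (Fin d) (Fin d) ℝ) {J : Matrix (Fin d) (Fin d) ℝ}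
    (hJ : IsUnit J.det) : nullity (Jᵀ * H * J) = nullity H := by
  have h1 := nullity_add_rank (Jᵀ * H * J)
  rw [Matrix.rank_mul_eq_left_of_isUnit_det _ _ hJ,
    Matrix.rank_mul_eq_right_of_isUnit_det _ _ (by rwa [Matrix.det_transpose])] at h1
  have h2 := nullity_add_rank H
  omega

theorem nullity_congruence_diagonal (a : Fin d → ℝ) {R : Matrix (Fin d) (Fin d) ℝ}
    (hR : IsUnit R.det) :
    nullity (Rᵀ * Matrix.diagonal a * R) = Fintype.card {i // a i = 0} := by
  rw [nullity_congruence _ hR]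
  have h := nullity_add_rank (Matrix.diagonal a)
  rw [Matrix.rank_diagonal, Fintype.card_subtype_compl, Fintype.card_fin] at h
  have := Fintype.card_subtype_le fun i => a i = 0
  rw [Fintype.card_fin] at this
  omega

theorem det_eq_zero_iff_nullity_pos (H : Matrix (Fin d) (Fin d) ℝ) :
    H.det = 0 ↔ 1 ≤ nullity H := by
  rw [← Matrix.exists_mulVec_eq_zero_iff, nullity, Nat.one_le_iff_ne_zero, ne_eq,
    Submodule.finrank_eq_zero, Submodule.eq_bot_iff]
  simp only [LinearMap.mem_ker, Matrix.mulVecLin_apply, not_forall]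
  exact exists_congr fun x => by rw [exists_prop, and_comm]

/-- Simultaneous diagonalization by congruence of two symmetric matrices, one of which is positive
definite. -/
theorem exists_simultaneous_diagonalization {G H : Matrix (Fin d) (Fin d) ℝ} (hG : G.PosDef)
    (hH : H.IsHermitian) :
    ∃ (R : Matrix (Fin d) (Fin d) ℝ) (ν : Fin d → ℝ), IsUnit R.det ∧
      G = Rᵀ * Matrix.diagonal 1 * R ∧ H = Rᵀ * Matrix.diagonal ν * R := by
  obtain ⟨U, hU, hUG⟩ := exists_orthogonal_diagonalization hG.isHermitian
  -- With `G = Bᵀ B`, the form `H` becomes `B⁻¹ᵀ H B⁻¹` in the coordinates `B x`. An orthogonal `V`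
  -- diagonalizing it leaves `G` equal to `(V B)ᵀ (V B)`.
  set B := Matrix.diagonal (fun i => √(hG.isHermitian.eigenvalues i)) * U with hB
  have hpos := hG.eigenvalues_pos
  have hBdet : IsUnit B.det := by
    rw [hB, Matrix.det_mul, Matrix.det_diagonal]
    refine IsUnit.mul (isUnit_iff_ne_zero.2 (Finset.prod_ne_zero_iff.2 fun i _ => ?_))
      (isUnit_det_of_transpose_mul_self hU)
    exact (Real.sqrt_pos.2 (hpos i)).ne'
  have hGB : G = Bᵀ * B := by
    rw [hB, Matrix.transpose_mul, Matrix.diagonal_transpose, Matrix.mul_assoc,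
      ← Matrix.mul_assoc (Matrix.diagonal _) (Matrix.diagonal _), Matrix.diagonal_mul_diagonal,
      ← Matrix.mul_assoc]
    conv_lhs => rw [hUG]
    congr 3
    funext i
    exact (Real.mul_self_sqrt (hpos i).le).symm
  have hM : (B⁻¹ᵀ * H * B⁻¹).IsHermitian := by
    have hHt : Hᵀ = H := by simpa [Matrix.IsHermitian] using hH
    simp [Matrix.IsHermitian, Matrix.mul_assoc, hHt]
  obtain ⟨V, hV, hVM⟩ := exists_orthogonal_diagonalization hM
  refine ⟨V * B, hM.eigenvalues, ?_, ?_, ?_⟩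
  · rw [Matrix.det_mul]
    exact (isUnit_det_of_transpose_mul_self hV).mul hBdet
  · rw [Matrix.diagonal_one', Matrix.mul_one, Matrix.transpose_mul, Matrix.mul_assoc,
      ← Matrix.mul_assoc Vᵀ, hV, Matrix.one_mul, hGB]
  · have : (V * B)ᵀ * Matrix.diagonal hM.eigenvalues * (V * B) =
        Bᵀ * (Vᵀ * Matrix.diagonal hM.eigenvalues * V) * B := by
      simp only [Matrix.transpose_mul, Matrix.mul_assoc]
    have hBt : Bᵀ * B⁻¹ᵀ = 1 := by
      rw [← Matrix.transpose_mul, Matrix.nonsing_inv_mul _ hBdet, Matrix.transpose_one]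
    rw [this, ← hVM]
    calc H = Bᵀ * B⁻¹ᵀ * H * (B⁻¹ * B) := by
          rw [hBt, Matrix.one_mul, Matrix.nonsing_inv_mul _ hBdet, Matrix.mul_one]
      _ = Bᵀ * (B⁻¹ᵀ * H * B⁻¹) * B := by simp only [Matrix.mul_assoc]

end LinearAlgebra

end DistanceLandscape

namespace DistanceLandscape

/-! ### Second derivatives at critical points and the squared distance -/

section Calculus

open Topology Filter

variable {E F : Type*} [NormedAddCommGroup E] [NormedSpace ℝ E] [NormedAddCommGroup F]
  [NormedSpace ℝ F]

theorem differentiableAt_fderiv {h : E → ℝ} {x : E} (hh : ContDiffAt ℝ 2 h x) :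
    DifferentiableAt ℝ (fderiv ℝ h) x :=
  (hh.fderiv_right (m := 1) (by norm_num)).differentiableAt (by norm_num)

/-- Second derivative of a composition at a point where the outer function is critical. -/
theorem fderiv_fderiv_comp_of_critical {h : E → ℝ} {φ : F → E} {x : F}
    (hh : ContDiffAt ℝ 2 h (φ x)) (hφ : ContDiffAt ℝ 2 φ x) (hcrit : fderiv ℝ h (φ x) = 0)
    (v w : F) :
    fderiv ℝ (fderiv ℝ fun u => h (φ u)) x v w =
      fderiv ℝ (fderiv ℝ h) (φ x) (fderiv ℝ φ x v) (fderiv ℝ φ x w) := by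
  have h1 : ∀ᶠ u in 𝓝 x, DifferentiableAt ℝ h (φ u) :=
    hφ.continuousAt.eventually
      ((hh.eventually (by simp)).mono fun y hy => hy.differentiableAt (by norm_num))
  have h2 : ∀ᶠ u in 𝓝 x, DifferentiableAt ℝ φ u :=
    (hφ.eventually (by simp)).mono fun y hy => hy.differentiableAt (by norm_num)
  have heq : (fderiv ℝ fun u => h (φ u)) =ᶠ[𝓝 x]
      fun u => (fderiv ℝ h (φ u)).comp (fderiv ℝ φ u) := by
    filter_upwards [h1, h2] with u hu hu'
    exact fderiv_comp u hu hu'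
  have hφ' : DifferentiableAt ℝ φ x := hφ.differentiableAt (by norm_num)
  have hd : HasFDerivAt (fun u => fderiv ℝ h (φ u))
      ((fderiv ℝ (fderiv ℝ h) (φ x)).comp (fderiv ℝ φ x)) x :=
    (differentiableAt_fderiv hh).hasFDerivAt.comp x hφ'.hasFDerivAt
  have hd' : HasFDerivAt (fderiv ℝ φ) (fderiv ℝ (fderiv ℝ φ) x) x :=
    ((hφ.fderiv_right (m := 1) (by norm_num)).differentiableAt (by norm_num)).hasFDerivAt
  -- The product rule also yields a term with the second derivative of `φ`, but it is paired with
  -- the differential of `h`, which vanishes.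
  rw [heq.fderiv_eq, (hd.clm_comp hd').fderiv]
  simp [hcrit]

/-- The matrix of a continuous bilinear form. -/
noncomputable def bilinMatrix {d : ℕ} (D : (Fin d → ℝ) →L[ℝ] (Fin d → ℝ) →L[ℝ] ℝ) :
    Matrix (Fin d) (Fin d) ℝ :=
  LinearMap.toMatrix₂' ℝ D.toLinearMap₁₂

theorem bilinMatrix_apply {d : ℕ} (D : (Fin d → ℝ) →L[ℝ] (Fin d → ℝ) →L[ℝ] ℝ) (i j : Fin d) :
    bilinMatrix D i j = D (Pi.single i 1) (Pi.single j 1) := by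
  simp [bilinMatrix]

theorem dotProduct_bilinMatrix_mulVec {d : ℕ} (D : (Fin d → ℝ) →L[ℝ] (Fin d → ℝ) →L[ℝ] ℝ)
    (v w : Fin d → ℝ) : v ⬝ᵥ (bilinMatrix D *ᵥ w) = D v w := by
  rw [← Matrix.toLinearMap₂'_apply', bilinMatrix, Matrix.toLinearMap₂'_toMatrix']
  rfl

theorem chartHessian_eq_bilinMatrix {n d : ℕ} (S : Matrix (Fin n) (Fin n) ℝ) (t : Fin n → ℝ)
    (p : (Fin d → ℝ) → (Fin n → ℝ)) :
    chartHessian S t p = bilinMatrix (fderiv ℝ (fderiv ℝ fun u => sqDist S t (p u)) 0) := by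
  ext i j
  rw [bilinMatrix_apply]
  rfl

theorem bilinMatrix_congruence {d : ℕ} {D D' : (Fin d → ℝ) →L[ℝ] (Fin d → ℝ) →L[ℝ] ℝ}
    {J : (Fin d → ℝ) →ₗ[ℝ] (Fin d → ℝ)} (h : ∀ v w, D' v w = D (J v) (J w)) :
    bilinMatrix D' = (LinearMap.toMatrix' J)ᵀ * bilinMatrix D * LinearMap.toMatrix' J := by
  rw [bilinMatrix, bilinMatrix, ← LinearMap.toMatrix₂'_compl₁₂]
  congr 1
  ext v w
  simp [h]

variable {n : ℕ}

/-- The bilinear form with Gram matrix `S`. -/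
noncomputable def gramForm (S : Matrix (Fin n) (Fin n) ℝ) : (Fin n → ℝ) →L[ℝ] (Fin n → ℝ) →L[ℝ] ℝ :=
  (Matrix.toLinearMap₂' ℝ S).toContinuousBilinearMap

theorem gramForm_apply (S : Matrix (Fin n) (Fin n) ℝ) (v w : Fin n → ℝ) :
    gramForm S v w = v ⬝ᵥ (S *ᵥ w) := by
  simp [gramForm, Matrix.toLinearMap₂'_apply']

theorem sqDist_eq_gramForm (S : Matrix (Fin n) (Fin n) ℝ) (t x : Fin n → ℝ) :
    sqDist S t x = gramForm S (x - t) (x - t) :=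
  (gramForm_apply ..).symm

theorem fderiv_sqDist (S : Matrix (Fin n) (Fin n) ℝ) (t x : Fin n → ℝ) :
    fderiv ℝ (sqDist S t) x = (gramForm S + (gramForm S).flip) (x - t) := by
  have hd : HasFDerivAt (fun x : Fin n → ℝ => x - t) (ContinuousLinearMap.id ℝ _) x :=
    (hasFDerivAt_id x).sub_const t
  have := (gramForm S).hasFDerivAt_of_bilinear hd hd
  rw [show sqDist S t = fun x => gramForm S (x - t) (x - t) from
    funext (sqDist_eq_gramForm S t), this.fderiv]
  ext w
  simp

theorem fderiv_fderiv_sqDist (S : Matrix (Fin n) (Fin n) ℝ) (t x : Fin n → ℝ) :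
    fderiv ℝ (fderiv ℝ (sqDist S t)) x = gramForm S + (gramForm S).flip := by
  rw [funext (fderiv_sqDist S t)]
  exact ((gramForm S + (gramForm S).flip).hasFDerivAt.comp x
    ((hasFDerivAt_id x).sub_const t)).fderiv

theorem contDiff_sqDist (S : Matrix (Fin n) (Fin n) ℝ) (t : Fin n → ℝ) :
    ContDiff ℝ ∞ (sqDist S t) := by
  rw [show sqDist S t = fun x => gramForm S (x - t) (x - t) from funext (sqDist_eq_gramForm S t)]
  fun_prop

/-- The weights `1 - r` and `r` sum to 1, so the quadratic parts in `x` agree, and the linear part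
is affine in the base point. The correction is constant in `x`, hence invisible to derivatives. -/
theorem sqDist_lineMap (S : Matrix (Fin n) (Fin n) ℝ) (s t x : Fin n → ℝ) (r : ℝ) :
    sqDist S (AffineMap.lineMap s t r) x =
      (1 - r) * sqDist S s x + r * sqDist S t x + (r ^ 2 - r) * sqDist S s t := by
  have h1 : x - AffineMap.lineMap s t r = (x - s) - r • (t - s) := by
    rw [AffineMap.lineMap_apply_module']; abel
  have h2 : x - t = (x - s) - (t - s) := by abel
  simp only [sqDist_eq_gramForm, h1, h2, map_sub, map_smul, sub_apply,
    smul_apply, smul_eq_mul]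
  ring

theorem fderiv_sqDist_lineMap (S : Matrix (Fin n) (Fin n) ℝ) (s t : Fin n → ℝ) (r : ℝ) :
    fderiv ℝ (sqDist S (AffineMap.lineMap s t r)) s = r • fderiv ℝ (sqDist S t) s := by
  rw [fderiv_sqDist, fderiv_sqDist, ← map_smul]
  congr 1
  rw [AffineMap.lineMap_apply_module', smul_sub, smul_sub]
  abel

end Calculus

/-! ### Hessians in charts and independence of the chart -/

section Charts

open Topology Filter

variable {n d : ℕ} {X : Set (Fin n → ℝ)} {s t : Fin n → ℝ} {U V : Set (Fin d → ℝ)}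
  {p q : (Fin d → ℝ) → (Fin n → ℝ)} {S : Matrix (Fin n) (Fin n) ℝ}

theorem IsChart.contDiffAt (hp : IsChart X s U p) : ContDiffAt ℝ ∞ p 0 :=
  hp.contDiffOn.contDiffAt (hp.isOpen_source.mem_nhds hp.zero_mem)

theorem IsChart.contDiffAt_sqDist (hp : IsChart X s U p) (S : Matrix (Fin n) (Fin n) ℝ)
    (t : Fin n → ℝ) : ContDiffAt ℝ ∞ (fun u => sqDist S t (p u)) 0 :=
  (contDiff_sqDist S t).contDiffAt.comp 0 hp.contDiffAt

/-- Along the line through `s` and `t` the Hessian is affine in the parameter. -/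
theorem IsChart.chartHessian_lineMap (hp : IsChart X s U p) (S : Matrix (Fin n) (Fin n) ℝ)
    (t : Fin n → ℝ) (r : ℝ) :
    chartHessian S (AffineMap.lineMap s t r) p =
      (1 - r) • chartHessian S s p + r • chartHessian S t p := by
  set a := fun u => sqDist S s (p u)
  set b := fun u => sqDist S t (p u)
  have ha : ContDiffAt ℝ ∞ a 0 := hp.contDiffAt_sqDist S s
  have hb : ContDiffAt ℝ ∞ b 0 := hp.contDiffAt_sqDist S t
  have hev : ∀ {f : (Fin d → ℝ) → ℝ}, ContDiffAt ℝ ∞ f 0 →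
      ∀ᶠ u in 𝓝 0, DifferentiableAt ℝ f u := fun hf =>
    ((hf.of_le (m := 1) (by norm_cast)).eventually (by simp)).mono
      fun y hy => hy.differentiableAt (by norm_num)
  have heq : (fderiv ℝ fun u => sqDist S (AffineMap.lineMap s t r) (p u)) =ᶠ[𝓝 0]
      fun u => (1 - r) • fderiv ℝ a u + r • fderiv ℝ b u := by
    filter_upwards [hev ha, hev hb] with u hau hbu
    have : (fun u => sqDist S (AffineMap.lineMap s t r) (p u)) =
        fun u => (1 - r) * a u + r * b u + (r ^ 2 - r) * sqDist S s t :=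
      funext fun u => sqDist_lineMap ..
    rw [this]
    exact (((hau.hasFDerivAt.const_mul (1 - r)).add (hbu.hasFDerivAt.const_mul r)).add_const
      _).fderiv
  have h2 : (2 : WithTop ℕ∞) ≤ ∞ := by norm_cast
  have hfd := (((differentiableAt_fderiv (ha.of_le h2)).hasFDerivAt.const_smul (1 - r)).add
    ((differentiableAt_fderiv (hb.of_le h2)).hasFDerivAt.const_smul r)).fderiv
  ext i j
  simp only [chartHessian, Matrix.of_apply, Matrix.add_apply, Matrix.smul_apply]
  rw [heq.fderiv_eq]
  exact congrArg (fun D => D (Pi.single i 1) (Pi.single j 1)) hfd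

theorem IsChart.isHermitian_chartHessian (hp : IsChart X s U p) (S : Matrix (Fin n) (Fin n) ℝ)
    (t : Fin n → ℝ) : (chartHessian S t p).IsHermitian := by
  have hsymm : IsSymmSndFDerivAt ℝ (fun u => sqDist S t (p u)) 0 :=
    (hp.contDiffAt_sqDist S t).isSymmSndFDerivAt
      (by rw [minSmoothness_of_isRCLikeNormedField]; norm_cast)
  ext i j
  exact hsymm.eq _ _

/-- For base point `s` the differential at `s` vanishes in all directions of `ℝⁿ`, so the Hessian at
`v` is `2 wᵀ S w` with `w = dp(0) v`, nonzero for `v ≠ 0` by immersivity. -/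
theorem IsChart.chartHessian_self_posDef (hp : IsChart X s U p) (hS : S.PosDef) :
    (chartHessian S s p).PosDef := by
  have h2 : (2 : WithTop ℕ∞) ≤ ∞ := by norm_cast
  refine Matrix.PosDef.of_dotProduct_mulVec_pos (hp.isHermitian_chartHessian S s) fun x hx => ?_
  have hcrit : fderiv ℝ (sqDist S s) (p 0) = 0 := by
    rw [fderiv_sqDist, hp.map_zero, sub_self, _root_.map_zero]
  have hne : fderiv ℝ p 0 x ≠ 0 := fun h0 =>
    hx (hp.injective_fderiv 0 hp.zero_mem (h0.trans (_root_.map_zero (fderiv ℝ p 0)).symm))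
  have hpos := hS.dotProduct_mulVec_pos hne
  rw [star_trivial, chartHessian_eq_bilinMatrix, dotProduct_bilinMatrix_mulVec,
    fderiv_fderiv_comp_of_critical ((contDiff_sqDist S s).contDiffAt.of_le h2)
      (hp.contDiffAt.of_le h2) hcrit, fderiv_fderiv_sqDist]
  simp only [add_apply, ContinuousLinearMap.flip_apply, gramForm_apply]
  rw [star_trivial] at hpos
  exact add_pos hpos hpos

/-- The transition map between two charts around the same point is smooth, and its differential is
injective. -/
theorem IsChart.exists_transition (hp : IsChart X s U p) (hq : IsChart X s V q) :
    ∃ φ : (Fin d → ℝ) → (Fin d → ℝ), φ 0 = 0 ∧ ContDiffAt ℝ ∞ φ 0 ∧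
      Function.Injective (fderiv ℝ φ 0) ∧ q =ᶠ[𝓝 0] fun u => p (φ u) := by
  have htop : (∞ : WithTop ℕ∞) ≠ 0 := by simp
  have hpd := hp.contDiffAt.differentiableAt htop
  -- A linear left inverse `A` of `dp(0)` makes `A ∘ p` a local diffeomorphism. With local inverse
  -- `g`, the map `g ∘ A` is a smooth left inverse of `p` near 0, and the transition map is `g ∘ A ∘
  -- q`.
  obtain ⟨A', hA'⟩ := LinearMap.exists_leftInverse_of_injective
    ((fderiv ℝ p 0) : (Fin d → ℝ) →ₗ[ℝ] (Fin n → ℝ))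
    (LinearMap.ker_eq_bot.2 (hp.injective_fderiv 0 hp.zero_mem))
  let A : (Fin n → ℝ) →L[ℝ] (Fin d → ℝ) := A'.toContinuousLinearMap
  have hAp : ContDiffAt ℝ ∞ (fun u => A (p u)) 0 := A.contDiff.contDiffAt.comp 0 hp.contDiffAt
  have hAp' : HasFDerivAt (fun u => A (p u))
      ((ContinuousLinearEquiv.refl ℝ (Fin d → ℝ) :) : (Fin d → ℝ) →L[ℝ] (Fin d → ℝ)) 0 := by
    have hcomp : A.comp (fderiv ℝ p 0) =
        ((ContinuousLinearEquiv.refl ℝ (Fin d → ℝ) :) : (Fin d → ℝ) →L[ℝ] (Fin d → ℝ)) :=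
      ContinuousLinearMap.ext fun v => LinearMap.congr_fun hA' v
    rw [← hcomp]
    exact A.hasFDerivAt.comp (0 : Fin d → ℝ) hpd.hasFDerivAt
  set g := hAp.localInverse hAp' htop
  have hg0 : g (A s) = 0 := by
    have := hAp.localInverse_apply_image hAp' htop
    rwa [hp.map_zero] at this
  have hgs : ContDiffAt ℝ ∞ g (A s) := by
    have := hAp.to_localInverse hAp' htop
    rwa [hp.map_zero] at this
  have hleft : ∀ᶠ u in 𝓝 0, g (A (p u)) = u :=
    (hAp.hasStrictFDerivAt' hAp' htop).eventually_left_inverse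
  have hφ : ContDiffAt ℝ ∞ (fun u => g (A (q u))) 0 := by
    refine ContDiffAt.comp (g := g) (f := fun u => A (q u)) 0 ?_
      (A.contDiff.contDiffAt.comp 0 hq.contDiffAt)
    simpa only [hq.map_zero] using hgs
  have hφ0 : g (A (q 0)) = 0 := by rw [hq.map_zero, hg0]
  obtain ⟨W, hW, hpW⟩ := hp.isOpen_image
  obtain ⟨W', -, hqW'⟩ := hq.isOpen_image
  have hsW : s ∈ W := (hpW ▸ (⟨0, hp.zero_mem, hp.map_zero⟩ : s ∈ p '' U) : s ∈ X ∩ W).2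
  obtain ⟨N, hN, hNsub⟩ := mem_nhds_iff.1 hleft
  -- The embedding property is essential here: points of `p '' U` close to `s` must have parameters
  -- close to 0, where `g ∘ A` inverts `p`.
  obtain ⟨O, hO, hON⟩ := hp.isEmbedding.isInducing.isOpen_iff.1
    (hNsub.1.preimage (continuous_subtype_val (p := (· ∈ U))))
  have hsO : s ∈ O := by
    have : (⟨0, hp.zero_mem⟩ : U) ∈ U.domRestrict p ⁻¹' O := by rw [hON]; exact hNsub.2
    simpa [hp.map_zero] using this
  have hqc : ContinuousAt q 0 := hq.contDiffAt.continuousAt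
  have heq : q =ᶠ[𝓝 0] fun u => p (g (A (q u))) := by
    filter_upwards [hq.isOpen_source.mem_nhds hq.zero_mem,
      hqc.preimage_mem_nhds (by rw [hq.map_zero]; exact hW.mem_nhds hsW),
      hqc.preimage_mem_nhds (by rw [hq.map_zero]; exact hO.mem_nhds hsO)] with u hu huW huO
    have huX : q u ∈ X := (hqW' ▸ Set.mem_image_of_mem q hu : q u ∈ X ∩ W').1
    obtain ⟨v, hv, hvq⟩ : q u ∈ p '' U := hpW ▸ ⟨huX, huW⟩
    have hvN : v ∈ N := by
      have : (⟨v, hv⟩ : U) ∈ U.domRestrict p ⁻¹' O := by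
        change p v ∈ O
        rw [hvq]; exact huO
      rw [hON] at this
      exact this
    have hgv : g (A (p v)) = v := hN hvN
    rw [← hvq, hgv]
  refine ⟨fun u => g (A (q u)), hφ0, hφ, ?_, heq⟩
  have hpd' : DifferentiableAt ℝ p (g (A (q 0))) := by rwa [hφ0]
  have hchain : fderiv ℝ q 0 =
      (fderiv ℝ p (g (A (q 0)))).comp (fderiv ℝ (fun u => g (A (q u))) 0) := by
    rw [heq.fderiv_eq]
    exact fderiv_comp (0 : Fin d → ℝ) hpd' (hφ.differentiableAt htop)
  have hinj := hq.injective_fderiv 0 hq.zero_mem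
  rw [hchain] at hinj
  exact Function.Injective.of_comp hinj

/-- At a critical point the nullity of the Hessian is the same in all charts. -/
theorem IsChart.nullity_chartHessian_eq (hp : IsChart X s U p) (hq : IsChart X s V q)
    (hs : s ∈ crit X d S t) : nullity (chartHessian S t q) = nullity (chartHessian S t p) := by
  have h2 : (2 : WithTop ℕ∞) ≤ ∞ := by norm_cast
  obtain ⟨φ, hφ0, hφ, hinj, heq⟩ := hp.exists_transition hq
  set h := fun u => sqDist S t (p u) with hh
  have hcrit : fderiv ℝ h (φ 0) = 0 := by
    have hL : DifferentiableAt ℝ (sqDist S t) (p 0) :=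
      (contDiff_sqDist S t).contDiffAt.differentiableAt (by simp)
    have hc : fderiv ℝ h 0 = (fderiv ℝ (sqDist S t) (p 0)).comp (fderiv ℝ p 0) :=
      fderiv_comp (0 : Fin d → ℝ) hL (hp.contDiffAt.differentiableAt (by simp))
    rw [hφ0, hc]
    ext v
    rw [hp.map_zero]
    exact hs.2 _ ⟨U, p, hp, v, rfl⟩
  have hsmooth : ContDiffAt ℝ 2 h (φ 0) := by
    rw [hφ0]; exact (hp.contDiffAt_sqDist S t).of_le h2
  have heq' : (fun u => sqDist S t (q u)) =ᶠ[𝓝 0] fun u => h (φ u) :=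
    heq.mono fun u hu => by simp only [hh, hu]
  have hD : ∀ v w, fderiv ℝ (fderiv ℝ fun u => sqDist S t (q u)) 0 v w =
      fderiv ℝ (fderiv ℝ h) 0 ((fderiv ℝ φ 0 : (Fin d → ℝ) →ₗ[ℝ] (Fin d → ℝ)) v)
        ((fderiv ℝ φ 0 : (Fin d → ℝ) →ₗ[ℝ] (Fin d → ℝ)) w) := by
    intro v w
    rw [heq'.fderiv.fderiv_eq,
      fderiv_fderiv_comp_of_critical hsmooth (hφ.of_le h2) hcrit, hφ0]
    rfl
  rw [chartHessian_eq_bilinMatrix, chartHessian_eq_bilinMatrix, bilinMatrix_congruence hD]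
  refine nullity_congruence _ ?_
  rw [LinearMap.det_toMatrix']
  exact (LinearMap.isUnit_iff_isUnit_det _).1
    ((LinearMap.isUnit_iff_ker_eq_bot _).2 (LinearMap.ker_eq_bot.2 hinj))

theorem crit_lineMap (hs : s ∈ crit X d S t) (r : ℝ) :
    s ∈ crit X d S (AffineMap.lineMap s t r) := by
  refine ⟨hs.1, fun w hw => ?_⟩
  rw [fderiv_sqDist_lineMap, smul_apply, hs.2 w hw, smul_zero]

/-- The definition lets the determinant and the nullity be taken in different charts; chart
independence at a critical point reduces both to one given chart. -/
theorem IsChart.isFocalPoint_iff (hp : IsChart X s U p) (hS : S.PosDef) (hs : s ∈ crit X d S t)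
    {m : ℕ} : IsFocalPoint X d S s t m ↔ 1 ≤ m ∧ nullity (chartHessian S t p) = m := by
  constructor
  · rintro ⟨hm, -, V, q, hq, hqm⟩
    exact ⟨hm, by rw [← hqm, hp.nullity_chartHessian_eq hq hs]⟩
  · rintro ⟨hm, hpm⟩
    exact ⟨hm, ⟨hS, hs, U, p, hp, (det_eq_zero_iff_nullity_pos _).2 (hpm ▸ hm)⟩, U, p, hp, hpm⟩

theorem IsChart.focalMultiplicity_eq (hp : IsChart X s U p) (hS : S.PosDef)
    (hs : s ∈ crit X d S t) : focalMultiplicity X d S s t = nullity (chartHessian S t p) := by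
  simp only [focalMultiplicity, hp.isFocalPoint_iff hS hs]
  generalize nullity (chartHessian S t p) = k
  -- For nullity 0 the set is empty, and the supremum of the empty set in `ℕ` is 0.
  rcases Nat.eq_zero_or_pos k with rfl | h0
  · have : {m : ℕ | 1 ≤ m ∧ 0 = m} = ∅ :=
      Set.eq_empty_of_forall_notMem fun m hm => absurd hm.1 (by simp [← hm.2])
    rw [this, csSup_empty, Nat.bot_eq_zero]
  · have : {m : ℕ | 1 ≤ m ∧ k = m} = {k} :=
      Set.ext fun m => ⟨fun hm => hm.2.symm, fun hm => by obtain rfl := hm; exact ⟨h0, rfl⟩⟩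
    rw [this, csSup_singleton]

end Charts

end DistanceLandscape

namespace DistanceLandscape

/-! ### Inertia along the line through the critical point -/

variable {n d : ℕ} {X : Set (Fin n → ℝ)} {s t : Fin n → ℝ} {U : Set (Fin d → ℝ)}
  {p : (Fin d → ℝ) → (Fin n → ℝ)} {S : Matrix (Fin n) (Fin n) ℝ}

/-- The Hessians along the line through `s` and `t` are diagonalized simultaneously: there are
real numbers `νᵢ` that determine both the index at `t` and all multiplicities on the line. -/
theorem IsChart.exists_inertia_data (hp : IsChart X s U p) (hS : S.PosDef)
    (hs : s ∈ crit X d S t) :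
    ∃ ν : Fin d → ℝ,
      negEigenvalueCount (chartHessian S t p) = Fintype.card {i // ν i < 0} ∧
      ∀ r : ℝ, focalMultiplicity X d S s (AffineMap.lineMap s t r) =
        Fintype.card {i // 1 - r + r * ν i = 0} := by
  obtain ⟨R, ν, hR, hG, hH⟩ := exists_simultaneous_diagonalization
    (hp.chartHessian_self_posDef hS) (hp.isHermitian_chartHessian S t)
  refine ⟨ν, ?_, fun r => ?_⟩
  · rw [hH, negEigenvalueCount_congruence_diagonal ν hR]
  · have hdiag : Matrix.diagonal (fun i => 1 - r + r * ν i) =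
        (1 - r) • Matrix.diagonal (1 : Fin d → ℝ) + r • Matrix.diagonal ν := by
      rw [← Matrix.diagonal_smul, ← Matrix.diagonal_smul, Matrix.diagonal_add]
      congr 1
      funext i
      simp
    rw [hp.focalMultiplicity_eq hS (crit_lineMap hs r), hp.chartHessian_lineMap, hG, hH,
      ← nullity_congruence_diagonal _ hR, hdiag]
    simp only [Matrix.mul_add, Matrix.add_mul, Matrix.mul_smul, Matrix.smul_mul]

theorem focalMultiplicity_eq_zero_of_notMem_focalLocus (ht : t ∉ focalLocus X d S) :
    focalMultiplicity X d S s t = 0 := by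
  have : {m | IsFocalPoint X d S s t m} = ∅ :=
    Set.eq_empty_of_forall_notMem fun m hm => ht ⟨s, hm.2.1⟩
  rw [focalMultiplicity, this, csSup_empty, Nat.bot_eq_zero]

end DistanceLandscape

/-! ### Counting focal points on the segment -/

open DistanceLandscape in
theorem theorem3p6 {n : ℕ} (X : Set (Fin n → ℝ)) (d : ℕ)
    (S : Matrix (Fin n) (Fin n) ℝ) (hS : S.PosDef)
    (t : Fin n → ℝ) (ht : t ∉ DistanceLandscape.focalLocus X d S)
    (s : Fin n → ℝ) (hs : s ∈ DistanceLandscape.crit X d S t) :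
    {y | y ∈ segment ℝ s t ∧ ∃ m, DistanceLandscape.IsFocalPoint X d S s y m}.Finite ∧
    ∀ (U : Set (Fin d → ℝ)) (p : (Fin d → ℝ) → (Fin n → ℝ)),
      DistanceLandscape.IsChart X s U p →
        DistanceLandscape.negEigenvalueCount (DistanceLandscape.chartHessian S t p) =
          ∑ᶠ y ∈ segment ℝ s t, DistanceLandscape.focalMultiplicity X d S s y := by
  classical
  have key : ∀ (U : Set (Fin d → ℝ)) (p : (Fin d → ℝ) → (Fin n → ℝ)), IsChart X s U p →
      (segment ℝ s t ∩ {y | focalMultiplicity X d S s y ≠ 0}).Finite ∧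
      negEigenvalueCount (chartHessian S t p) =
        ∑ᶠ y ∈ segment ℝ s t, focalMultiplicity X d S s y := by
    intro U p hp
    obtain ⟨ν, hneg, hmult⟩ := hp.exists_inertia_data hS hs
    -- A zero `ν i` would be a root at `r = 1`, making `t` focal.
    have hν : ∀ i, ν i ≠ 0 := by
      intro i hi
      have h1 := hmult 1
      rw [AffineMap.lineMap_apply_one, focalMultiplicity_eq_zero_of_notMem_focalLocus ht] at h1
      exact (Fintype.card_eq_zero_iff.1 h1.symm).false ⟨i, by simp [hi]⟩
    let f : Fin d → (Fin n → ℝ) := fun i => AffineMap.lineMap s t (1 / (1 - ν i))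
    let N : Finset (Fin d) := Finset.univ.filter fun i => ν i < 0
    have hroot : ∀ i (r : ℝ), ν i < 0 → (1 - r + r * ν i = 0 ↔ r = 1 / (1 - ν i)) := by
      intro i r hi
      rw [eq_div_iff (by linarith)]
      constructor <;> intro h <;> linarith
    have hneg_of : ∀ i, ∀ r ∈ Set.Icc (0 : ℝ) 1, 1 - r + r * ν i = 0 → ν i < 0 := by
      intro i r hr h
      refine lt_of_le_of_ne (not_lt.1 fun hpos => ?_) (hν i)
      rcases hr.1.eq_or_lt with rfl | h0
      · norm_num at h
      · have := mul_pos h0 hpos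
        linarith [hr.2]
    have hmem : ∀ i, ν i < 0 → 1 / (1 - ν i) ∈ Set.Icc (0 : ℝ) 1 := fun i hi =>
      ⟨by have : 0 < 1 - ν i := by linarith
          positivity, (div_le_one (by linarith)).2 (by linarith)⟩
    have hsub : segment ℝ s t ∩ {y | focalMultiplicity X d S s y ≠ 0} ⊆ N.image f := by
      rintro y ⟨hy, hy0⟩
      rw [segment_eq_image_lineMap] at hy
      obtain ⟨r, hr, rfl⟩ := hy
      rw [Set.mem_ofPred_eq, hmult, ← Nat.pos_iff_ne_zero, Fintype.card_pos_iff] at hy0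
      obtain ⟨i, hi⟩ := hy0
      have hi0 := hneg_of i r hr hi
      rw [Finset.coe_image]
      refine ⟨i, by simpa [N] using hi0, ?_⟩
      simp only [f]
      rw [← (hroot i r hi0).1 hi]
    -- If `s = t`, all parameters give the same point, yet the count is 0 at `r = 0` and positive at
    -- `1 / (1 - ν i)`. So `s ≠ t`, and distinct parameters give distinct points.
    have hst : ∀ i, ν i < 0 → s ≠ t := by
      rintro i hi rfl
      have h0 := hmult 0
      have h1 := hmult (1 / (1 - ν i))
      rw [AffineMap.lineMap_same_apply] at h0 h1
      rw [h0] at h1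
      have : Nonempty {j // 1 - 1 / (1 - ν i) + 1 / (1 - ν i) * ν j = 0} :=
        ⟨i, (hroot i _ hi).2 rfl⟩
      exact Fintype.card_ne_zero (by rw [← h1]; simp)
    refine ⟨(Finset.finite_toSet _).subset hsub, ?_⟩
    have himg : (↑(N.image f) : Set (Fin n → ℝ)) ⊆ segment ℝ s t := by
      rw [Finset.coe_image]
      rintro _ ⟨i, hi, rfl⟩
      rw [segment_eq_image_lineMap]
      exact ⟨_, hmem i (by simpa [N] using hi), rfl⟩
    have hsum : ∑ᶠ y ∈ segment ℝ s t, focalMultiplicity X d S s y =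
        ∑ y ∈ N.image f, focalMultiplicity X d S s y := by
      refine finsum_mem_eq_sum_of_inter_support_eq _ (Set.ext fun y => ?_)
      exact ⟨fun h => ⟨hsub h, h.2⟩, fun h => ⟨himg h.1, h.2⟩⟩
    -- The negative `ν i` are grouped by the focal point `f i` they produce; the fibre over a point
    -- has as many elements as its multiplicity.
    rw [hsum, hneg, Fintype.card_subtype, Finset.card_eq_sum_card_image f N]
    refine Finset.sum_congr rfl fun y hy => ?_
    obtain ⟨i, hi, rfl⟩ := Finset.mem_image.1 hy
    have hi0 : ν i < 0 := by simpa [N] using hi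
    simp only [f]
    rw [hmult, Fintype.card_subtype]
    congr 1
    ext j
    simp only [N, Finset.mem_filter, Finset.mem_univ, true_and]
    constructor
    · rintro ⟨hj, hji⟩
      rw [hroot j _ hj]
      exact (AffineMap.lineMap_injective ℝ (hst i hi0) hji).symm
    · intro hj
      have hj0 := hneg_of j _ (hmem i hi0) hj
      exact ⟨hj0, by rw [(hroot j _ hj0).1 hj]⟩
  refine ⟨?_, fun U p hp => (key U p hp).2⟩
  -- Finiteness does not mention a chart, so one is supplied by the regularity of `s`.
  obtain ⟨U, p, hp⟩ := hs.1
  refine (key U p hp).1.subset ?_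
  rintro y ⟨hy, m, hm⟩
  refine ⟨hy, ?_⟩
  rw [Set.mem_ofPred_eq, hp.focalMultiplicity_eq hS hm.2.1.2.1]
  have := (hp.isFocalPoint_iff hS hm.2.1.2.1).1 hm
  omega
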